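/- Let $m\ge 2$ and $k\ge 1$ be integers, and let $B$ be the closed Euclidean unit ball of $\mathbb R^m$ centered at the origin. Let $\mu$ be a probability measure on $B$ such that (a1) $\mu$ is invariant under rotations about the origin; (a2) every relatively open subset of $B$ containing the origin has positive $\mu$-measure; (a3) every subset of $B$ of Lebesgue measure zero has $\mu$-measure zero. Assume that $\mu$ has a density $f$ with respect to Lebesgue measure on $B$ such that $f(x_1)>f(x_2)$ for all $x_1,x_2\in B$ with $\|x_1\|<\|x_2\|$. Let $c_1,\dots,c_k\in\mathbb R^m$ satisfy $\|c_i-c_j\|>2$ for all $i\ne j$. For $n\ge 1$, draw independent vectors $v^{(i)}_\ell$ ($1\le i\le k$, $1\le \ell\le n$) according to $\mu$, and let $P$ be the collection of the $kn$ points $x^{(i)}_\ell=c_i+v^{(i)}_\ell$ (stochastic ball model); $x^{(i)}_\ell$ is said to be drawn from the $i$-th ball. Consider the $k$-median linear program $$\min \sum_{p,q\in P}\|p-q\|\,z_{pq}\quad\text{s.t.}\quad \sum_{p\in P}z_{pq}=1\ \ \forall q\in P,\qquad z_{pq}\le y_p\ \ \forall p,q\in P,\qquad \sum_{p\in P}y_p=k,\qquad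 y_p,z_{pq}\ge 0\ \ \forall p,q\in P .$$ Say that it achieves exact recovery if it has a unique optimal solution $(y,z)$, all entries of this solution are in $\{0,1\}$, and it assigns each point to the ball from which it is drawn, that is, $z_{pq}=1$ if and only if $y_p=1$ and $p,q$ are drawn from the same ball. Then the linear program achieves exact recovery with high probability: for every $\delta\in(0,1)$ there is $N$ such that for every $n>N$ the probability of exact recovery is greater than $1-\delta$. -/

import Mathlib

open MeasureTheory

namespace KMedian

section LP

variable {P : Type*} [Fintype P]

/-- The objective `∑_{p,q} d(p,q) z_{pq}` of the `k`-median integer program and of its linear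
programming relaxation. -/
noncomputable def objective (d : P → P → ℝ) (z : P → P → ℝ) : ℝ :=
  ∑ p, ∑ q, d p q * z p q

/-- Feasibility for the `k`-median linear programming relaxation (LP). -/
structure LPFeasible (k : ℕ) (y : P → ℝ) (z : P → P → ℝ) : Prop where
  sum_assign : ∀ q, ∑ p, z p q = 1
  le_center : ∀ p q, z p q ≤ y p
  sum_center : ∑ p, y p = k
  center_nonneg : ∀ p, 0 ≤ y p
  assign_nonneg : ∀ p q, 0 ≤ z p q

/-- Feasibility for the `k`-median integer program (IP). -/
structure IPFeasible (k : ℕ) (y : P → ℝ) (z : P → P → ℝ) : Prop where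
  sum_assign : ∀ q, ∑ p, z p q = 1
  le_center : ∀ p q, z p q ≤ y p
  sum_center : ∑ p, y p = k
  center_binary : ∀ p, y p = 0 ∨ y p = 1
  assign_binary : ∀ p q, z p q = 0 ∨ z p q = 1

/-- `(y, z)` is an optimal solution of (LP). -/
def LPOptimal (k : ℕ) (d : P → P → ℝ) (y : P → ℝ) (z : P → P → ℝ) : Prop :=
  LPFeasible k y z ∧ ∀ y' z', LPFeasible k y' z' → objective d z ≤ objective d z'

/-- Exact recovery: (LP) has a unique optimal solution `(y, z)`, this solution is feasible to (IP),
and it assigns each point to the ball from which it is drawn, i.e. a point `q` is assigned to `p`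
exactly when `p` is a chosen center drawn from the same ball as `q`. Here `ball p` is the index of
the ball from which the point `p` is drawn. -/
def ExactRecovery {k : ℕ} (d : P → P → ℝ) (ball : P → Fin k) : Prop :=
  ∃ y z, LPOptimal k d y z ∧ (∀ y' z', LPOptimal k d y' z' → y' = y ∧ z' = z) ∧
    IPFeasible k y z ∧ ∀ p q, z p q = 1 ↔ y p = 1 ∧ ball p = ball q

end LP

section Model

variable {m : ℕ}

/-- (a1): `μ` is invariant under rotations centered in the origin (the orthogonal maps of
determinant `1`). -/
def RotationInvariant (μ : Measure (EuclideanSpace ℝ (Fin m))) : Prop :=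
  ∀ f : EuclideanSpace ℝ (Fin m) ≃ₗᵢ[ℝ] EuclideanSpace ℝ (Fin m),
    LinearMap.det (f.toLinearEquiv : EuclideanSpace ℝ (Fin m) →ₗ[ℝ] EuclideanSpace ℝ (Fin m)) = 1 →
      μ.map f = μ

/-- (a2): every relatively open subset of the unit ball containing the origin has positive
measure. -/
def PositiveNearCenter (μ : Measure (EuclideanSpace ℝ (Fin m))) : Prop :=
  ∀ U : Set (EuclideanSpace ℝ (Fin m)), IsOpen U → 0 ∈ U → 0 < μ (U ∩ Metric.closedBall 0 1)

/-- (a3): every subset of the unit ball of zero Lebesgue measure has zero measure. -/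
def NullOnLebesgueNull (μ : Measure (EuclideanSpace ℝ (Fin m))) : Prop :=
  ∀ S : Set (EuclideanSpace ℝ (Fin m)), S ⊆ Metric.closedBall 0 1 → volume S = 0 → μ S = 0

/-- The joint law of the `k * n` i.i.d. vectors `v i ℓ` drawn according to `μ`, indexed by pairs
`(i, ℓ)`. -/
noncomputable def sampleLaw (k n : ℕ) (μ : Measure (EuclideanSpace ℝ (Fin m))) :
    Measure (Fin k × Fin n → EuclideanSpace ℝ (Fin m)) :=
  Measure.pi fun _ => μ

/-- The data points `x i ℓ = c i + v i ℓ` of the stochastic ball model. -/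
def sbmPoint {k n : ℕ} (c : Fin k → EuclideanSpace ℝ (Fin m))
    (v : Fin k × Fin n → EuclideanSpace ℝ (Fin m)) (p : Fin k × Fin n) :
    EuclideanSpace ℝ (Fin m) :=
  c p.1 + v p

/-- The event that (LP) achieves exact recovery on the data points of the stochastic ball model. -/
def recoveryEvent {k : ℕ} (n : ℕ) (c : Fin k → EuclideanSpace ℝ (Fin m)) :
    Set (Fin k × Fin n → EuclideanSpace ℝ (Fin m)) :=
  {v | ExactRecovery (fun p q => dist (sbmPoint c v p) (sbmPoint c v q))
    (fun p : Fin k × Fin n => p.1)}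

end Model

/-- `A n` happens with high probability: for every `δ ∈ (0,1)`, the probability of `A n` exceeds
`1 - δ` for all large `n`. It is written as `Pr (complement of A n) < δ`: the same for events,
and for sets not known to be measurable it bounds the outer measure of the exceptional set. -/
def WithHighProbability {Ω : ℕ → Type*} [∀ n, MeasurableSpace (Ω n)]
    (Pr : ∀ n, Measure (Ω n)) (A : ∀ n, Set (Ω n)) : Prop :=
  ∀ δ : ℝ, 0 < δ → δ < 1 → ∃ N : ℕ, ∀ n, N < n → Pr n (A n)ᶜ < ENNReal.ofReal δ

end KMedian

/-!
A dual solution of the linear program consists of prices `α_q` and a bound `ω` on the contributions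
`∑_q (α_q - d(p,q))⁺`. If opening a center in each ball is tight for such a solution, and strictly
so at all other points, then complementary slackness makes it the unique optimal solution.

Take as center of each ball the medoid of its sample, and give all points of a ball the same price,
chosen such that the medoid collects a contribution of exactly `ω = n g(0)`, where `g(x)` is the
expected contribution `E (α - ‖x - v‖)⁺` for a price `α` slightly above the radius. By the law of
large numbers, uniform over a compact set because contributions are Lipschitz, the contribution of
a point at offset `x` from its center `c i` is close to `n ∑_j g(c i - c j + x)`. By the layer cake
formula this sum is an integral over `t` of the masses of disjoint balls of radius `α - t`, and as
the density decreases radially, the central ball outweighs them together (a bathtub argument). So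
all points away from the centers contribute strictly less than `ω`; near the centers the
contributions are ordered by the total distance to the sample, which has almost surely no ties.
-/

namespace KMedian

section Duality

variable {P : Type*} [Fintype P] {k : ℕ} {d : P → P → ℝ} {y : P → ℝ} {z : P → P → ℝ}

/-- The contribution `∑_q (α_q - d(p,q))⁺` of the point `p`. The dual of (LP) is to maximize
`∑_q α_q - k ω` subject to every contribution being at most `ω`, once the dual variables of the
constraints `z_{pq} ≤ y_p` have been given their best values `(α_q - d(p,q))⁺`. -/
noncomputable def contribution (d : P → P → ℝ) (α : P → ℝ) (p : P) : ℝ :=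
  ∑ q, max (α q - d p q) 0

theorem LPFeasible.mul_assign_le (h : LPFeasible k y z) (d : P → P → ℝ) (α : P → ℝ) (p q : P) :
    (α q - d p q) * z p q ≤ max (α q - d p q) 0 * y p :=
  (mul_le_mul_of_nonneg_right (le_max_left _ _) (h.assign_nonneg p q)).trans
    (mul_le_mul_of_nonneg_left (h.le_center p q) (le_max_right _ _))

theorem LPFeasible.objective_eq_dual_add_slack (h : LPFeasible k y z) (d : P → P → ℝ)
    (α : P → ℝ) (ω : ℝ) :
    objective d z = (∑ q, α q - k * ω) + (∑ p, (ω - contribution d α p) * y p +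
      ∑ p, ∑ q, (max (α q - d p q) 0 * y p - (α q - d p q) * z p q)) := by
  have hα : ∑ p, ∑ q, α q * z p q = ∑ q, α q := by
    rw [Finset.sum_comm]
    simp only [← Finset.mul_sum, h.sum_assign, mul_one]
  have hω : ∑ p, ω * y p = k * ω := by rw [← Finset.mul_sum, h.sum_center, mul_comm]
  simp only [objective, contribution, sub_mul, Finset.sum_mul, Finset.sum_sub_distrib, hα, hω]
  ring

theorem LPFeasible.dual_le_objective (h : LPFeasible k y z) {α : P → ℝ} {ω : ℝ}
    (hω : ∀ p, contribution d α p ≤ ω) : ∑ q, α q - k * ω ≤ objective d z := by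
  rw [h.objective_eq_dual_add_slack d α ω]
  exact le_add_of_nonneg_right <| add_nonneg
    (Finset.sum_nonneg fun p _ => mul_nonneg (sub_nonneg.2 (hω p)) (h.center_nonneg p))
    (Finset.sum_nonneg fun p _ => Finset.sum_nonneg fun q _ =>
      sub_nonneg.2 (h.mul_assign_le d α p q))

theorem LPFeasible.complementary_slackness (h : LPFeasible k y z) {α : P → ℝ} {ω : ℝ}
    (hω : ∀ p, contribution d α p ≤ ω) (hobj : objective d z ≤ ∑ q, α q - k * ω) :
    (∀ p, (ω - contribution d α p) * y p = 0) ∧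
      ∀ p q, max (α q - d p q) 0 * y p = (α q - d p q) * z p q := by
  have hcenter : ∀ p ∈ Finset.univ, 0 ≤ (ω - contribution d α p) * y p := fun p _ =>
    mul_nonneg (sub_nonneg.2 (hω p)) (h.center_nonneg p)
  have hassign : ∀ p, ∀ q ∈ Finset.univ,
      0 ≤ max (α q - d p q) 0 * y p - (α q - d p q) * z p q := fun p q _ =>
    sub_nonneg.2 (h.mul_assign_le d α p q)
  have hassign_sum := fun p (_ : p ∈ Finset.univ) => Finset.sum_nonneg (hassign p)
  rw [h.objective_eq_dual_add_slack d α ω, add_le_iff_nonpos_right] at hobj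
  obtain ⟨hcenter_zero, hassign_zero⟩ := (add_eq_zero_iff_of_nonneg (Finset.sum_nonneg hcenter)
    (Finset.sum_nonneg hassign_sum)).1
      (hobj.antisymm (add_nonneg (Finset.sum_nonneg hcenter) (Finset.sum_nonneg hassign_sum)))
  rw [Finset.sum_eq_zero_iff_of_nonneg hcenter] at hcenter_zero
  rw [Finset.sum_eq_zero_iff_of_nonneg hassign_sum] at hassign_zero
  exact ⟨fun p => hcenter_zero p (Finset.mem_univ p), fun p q => sub_eq_zero.1 <|
    (Finset.sum_eq_zero_iff_of_nonneg (hassign p)).1 (hassign_zero p (Finset.mem_univ p)) q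
      (Finset.mem_univ q)⟩

end Duality

section ClusterAssignment

variable {P : Type*} {k : ℕ} {ball : P → Fin k} {s : Fin k → P}

open scoped Classical in
/-- The integral solution `z` that assigns every point `q` to the center `s i` of its ball. When
`s i` lies in ball `i`, the diagonal `z_{pp}` indicates the chosen centers, so it serves as `y`. -/
noncomputable def clusterAssignment (ball : P → Fin k) (s : Fin k → P) (p q : P) : ℝ :=
  if p = s (ball q) then 1 else 0

theorem clusterAssignment_eq_one_iff {p q : P} :
    clusterAssignment ball s p q = 1 ↔ p = s (ball q) := by
  simp [clusterAssignment]

theorem clusterAssignment_of_ne {p q : P} (h : p ≠ s (ball q)) :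
    clusterAssignment ball s p q = 0 := if_neg h

theorem clusterAssignment_binary (p q : P) :
    clusterAssignment ball s p q = 0 ∨ clusterAssignment ball s p q = 1 := by
  unfold clusterAssignment
  split_ifs <;> simp

theorem clusterAssignment_nonneg (p q : P) : 0 ≤ clusterAssignment ball s p q := by
  rcases clusterAssignment_binary (ball := ball) (s := s) p q with h | h <;> simp [h]

theorem clusterAssignment_eq_one_iff_diag (hs : Function.RightInverse s ball) {p q : P} :
    clusterAssignment ball s p q = 1 ↔ clusterAssignment ball s p p = 1 ∧ ball p = ball q := by
  simp only [clusterAssignment_eq_one_iff]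
  constructor
  · rintro rfl
    simp [hs (ball q)]
  · rintro ⟨hp, hpq⟩
    exact hpq ▸ hp

theorem clusterAssignment_le_diag (hs : Function.RightInverse s ball) (p q : P) :
    clusterAssignment ball s p q ≤ clusterAssignment ball s p p := by
  rcases clusterAssignment_binary (ball := ball) (s := s) p q with h | h
  · exact h ▸ clusterAssignment_nonneg p p
  · rw [h, ((clusterAssignment_eq_one_iff_diag hs).1 h).1]

variable [Fintype P]

theorem sum_clusterAssignment (q : P) : ∑ p, clusterAssignment ball s p q = 1 :=
  (Fintype.sum_eq_single _ fun _ hp => clusterAssignment_of_ne hp).trans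
    (clusterAssignment_eq_one_iff.2 rfl)

theorem sum_clusterAssignment_diag (hs : Function.RightInverse s ball) :
    ∑ p, clusterAssignment ball s p p = k := by
  classical
  have hdiag : ∀ p, clusterAssignment ball s p p = ∑ i, if p = s i then 1 else 0 := by
    intro p
    rw [Finset.sum_eq_single_of_mem (ball p) (Finset.mem_univ _) fun i _ hi => if_neg ?_]
    · simp only [clusterAssignment]
    · rintro rfl
      exact hi (hs i).symm
  simp only [hdiag]
  rw [Finset.sum_comm]
  simp

theorem lpFeasible_clusterAssignment (hs : Function.RightInverse s ball) :
    LPFeasible k (fun p => clusterAssignment ball s p p) (clusterAssignment ball s) :=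
  ⟨sum_clusterAssignment, clusterAssignment_le_diag hs, sum_clusterAssignment_diag hs,
    fun p => clusterAssignment_nonneg p p, clusterAssignment_nonneg⟩

theorem ipFeasible_clusterAssignment (hs : Function.RightInverse s ball) :
    IPFeasible k (fun p => clusterAssignment ball s p p) (clusterAssignment ball s) :=
  ⟨sum_clusterAssignment, clusterAssignment_le_diag hs, sum_clusterAssignment_diag hs,
    fun p => clusterAssignment_binary p p, clusterAssignment_binary⟩

theorem LPFeasible.eq_clusterAssignment {y : P → ℝ} {z : P → P → ℝ} (h : LPFeasible k y z)
    (hs : Function.RightInverse s ball) (hz : ∀ p q, p ≠ s (ball q) → z p q = 0) :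
    y = (fun p => clusterAssignment ball s p p) ∧ z = clusterAssignment ball s := by
  have hassign : z = clusterAssignment ball s := by
    ext p q
    by_cases hp : p = s (ball q)
    · rw [clusterAssignment_eq_one_iff.2 hp, ← h.sum_assign q, hp]
      exact (Fintype.sum_eq_single _ fun p hp => hz p q hp).symm
    · rw [hz p q hp, clusterAssignment_of_ne hp]
  refine ⟨funext fun p => ?_, hassign⟩
  have hle : ∀ p ∈ Finset.univ, clusterAssignment ball s p p ≤ y p := fun p _ =>
    hassign ▸ h.le_center p p
  exact ((Finset.sum_eq_sum_iff_of_le hle).1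
    ((sum_clusterAssignment_diag hs).trans h.sum_center.symm) p (Finset.mem_univ p)).symm

end ClusterAssignment

section DualCertificate

variable {P : Type*} [Fintype P] {k : ℕ} {d : P → P → ℝ} {ball : P → Fin k} {s : Fin k → P}
  {α : P → ℝ} {ω : ℝ}

/-- A dual solution `(α, ω)` certifying that opening the center `s i` in each ball `i` is the only
optimal solution of (LP): the strict inequalities make complementary slackness rule out every other
solution. -/
structure IsDualCertificate (d : P → P → ℝ) (ball : P → Fin k) (s : Fin k → P) (α : P → ℝ)
    (ω : ℝ) : Prop where
  ball_center : Function.RightInverse s ball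
  dist_center_le : ∀ q, d (s (ball q)) q ≤ α q
  lt_dist_center : ∀ i q, ball q ≠ i → α q < d (s i) q
  contribution_center : ∀ i, contribution d α (s i) = ω
  contribution_lt : ∀ p ∉ Set.range s, contribution d α p < ω

namespace IsDualCertificate

theorem contribution_le (h : IsDualCertificate d ball s α ω) (p : P) : contribution d α p ≤ ω := by
  by_cases hp : p ∈ Set.range s
  · obtain ⟨i, rfl⟩ := hp
    exact (h.contribution_center i).le
  · exact (h.contribution_lt p hp).le

theorem objective_clusterAssignment (h : IsDualCertificate d ball s α ω) :
    objective d (clusterAssignment ball s) = ∑ q, α q - k * ω := by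
  have hcenter : ∀ p, (ω - contribution d α p) * clusterAssignment ball s p p = 0 := by
    intro p
    by_cases hp : p = s (ball p)
    · rw [hp, h.contribution_center, sub_self, zero_mul]
    · rw [clusterAssignment_of_ne hp, mul_zero]
  have hassign : ∀ p q, max (α q - d p q) 0 * clusterAssignment ball s p p -
      (α q - d p q) * clusterAssignment ball s p q = 0 := by
    intro p q
    by_cases hpq : p = s (ball q)
    · have hone : clusterAssignment ball s p q = 1 := clusterAssignment_eq_one_iff.2 hpq
      rw [hone, ((clusterAssignment_eq_one_iff_diag h.ball_center).1 hone).1, hpq,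
        max_eq_left (sub_nonneg.2 (h.dist_center_le q)), sub_self]
    rw [clusterAssignment_of_ne hpq, mul_zero, sub_zero]
    by_cases hp : p = s (ball p)
    · have hball : ball q ≠ ball p := fun hb => hpq (hb ▸ hp)
      rw [max_eq_right (sub_nonpos.2 (hp ▸ (h.lt_dist_center _ q hball).le)), zero_mul]
    · rw [clusterAssignment_of_ne hp, mul_zero]
  rw [(lpFeasible_clusterAssignment h.ball_center).objective_eq_dual_add_slack d α ω]
  simp only [hcenter, hassign, Finset.sum_const_zero, add_zero]

theorem assign_eq_zero (h : IsDualCertificate d ball s α ω) {y : P → ℝ} {z : P → P → ℝ}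
    (hyz : LPFeasible k y z) (hobj : objective d z ≤ ∑ q, α q - k * ω) (p q : P)
    (hpq : p ≠ s (ball q)) : z p q = 0 := by
  obtain ⟨hcenter, hassign⟩ := hyz.complementary_slackness h.contribution_le hobj
  by_cases hp : p ∈ Set.range s
  · obtain ⟨i, rfl⟩ := hp
    have hlt : α q - d (s i) q < 0 :=
      sub_neg.2 (h.lt_dist_center i q fun hi => hpq (congrArg s hi.symm))
    have hzero := hassign (s i) q
    rw [max_eq_right hlt.le, zero_mul, eq_comm] at hzero
    exact (mul_eq_zero.1 hzero).resolve_left hlt.ne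
  · have hy : y p = 0 :=
      (mul_eq_zero.1 (hcenter p)).resolve_left (sub_pos.2 (h.contribution_lt p hp)).ne'
    exact ((hyz.le_center p q).trans hy.le).antisymm (hyz.assign_nonneg p q)

theorem exactRecovery (h : IsDualCertificate d ball s α ω) : ExactRecovery d ball := by
  have hfeas := lpFeasible_clusterAssignment h.ball_center
  refine ⟨_, _, ⟨hfeas, fun y z hyz => ?_⟩, fun y z hyz => ?_,
    ipFeasible_clusterAssignment h.ball_center,
    fun p q => clusterAssignment_eq_one_iff_diag h.ball_center⟩
  · rw [h.objective_clusterAssignment]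
    exact hyz.dual_le_objective h.contribution_le
  · have hobj := (hyz.2 _ _ hfeas).trans_eq h.objective_clusterAssignment
    exact hyz.1.eq_clusterAssignment h.ball_center (h.assign_eq_zero hyz.1 hobj)

end IsDualCertificate

end DualCertificate

section SampleContribution

variable {E : Type*} [SeminormedAddCommGroup E] {κ : Type*} [Fintype κ] {a b δ : ℝ} {u : κ → E}
  {x y : E}

/-- The total distance from the position `x` to the points of the sample `u`. -/
noncomputable def totalDist (u : κ → E) (x : E) : ℝ :=
  ∑ l, ‖x - u l‖

/-- The contribution `∑_l (a - ‖x - u_l‖)⁺` of the position `x`, as far as it comes from a single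
ball whose points `u_l` all have the same dual price `a`. -/
noncomputable def sampleContribution (a : ℝ) (u : κ → E) (x : E) : ℝ :=
  ∑ l, max (a - ‖x - u l‖) 0

theorem sampleContribution_nonneg : 0 ≤ sampleContribution a u x :=
  Finset.sum_nonneg fun _ _ => le_max_right _ _

theorem sampleContribution_le_add (hδ : 0 ≤ δ) (hab : b ≤ a + δ) :
    sampleContribution b u x ≤ sampleContribution a u x + Fintype.card κ * δ := by
  calc sampleContribution b u x ≤ ∑ l, (max (a - ‖x - u l‖) 0 + δ) :=
        Finset.sum_le_sum fun l _ => max_le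
          (by linarith [le_max_left (a - ‖x - u l‖) 0]) (add_nonneg (le_max_right _ _) hδ)
    _ = sampleContribution a u x + Fintype.card κ * δ := by
        simp [sampleContribution, Finset.sum_add_distrib]

theorem sampleContribution_eq_of_forall_norm_sub_le (h : ∀ l, ‖x - u l‖ ≤ a) :
    sampleContribution a u x = Fintype.card κ * a - totalDist u x := by
  simp only [sampleContribution, totalDist, max_eq_left (sub_nonneg.2 (h _)),
    Finset.sum_sub_distrib, Finset.sum_const, Finset.card_univ, nsmul_eq_mul]

theorem sampleContribution_eq_zero (h : ∀ l, a ≤ ‖x - u l‖) : sampleContribution a u x = 0 :=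
  Finset.sum_eq_zero fun l _ => max_eq_right (sub_nonpos.2 (h l))

theorem card_mul_sub_totalDist_le_sampleContribution :
    Fintype.card κ * a - totalDist u x ≤ sampleContribution a u x := by
  calc Fintype.card κ * a - totalDist u x = ∑ l, (a - ‖x - u l‖) := by
        simp [totalDist, Finset.sum_sub_distrib]
    _ ≤ sampleContribution a u x := Finset.sum_le_sum fun _ _ => le_max_left _ _

end SampleContribution

section TypicalSample

variable {E : Type*} [SeminormedAddCommGroup E] {n : ℕ} {g : E → ℝ} {K : Set E} {b η : ℝ}
  {u : Fin n → E} {l : Fin n}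

/-- `u l` is a medoid of the sample `u`: a sample point of least total distance to the sample. -/
def IsMedoid (u : Fin n → E) (l : Fin n) : Prop :=
  ∀ j, totalDist u (u l) ≤ totalDist u (u j)

/-- The dual price for which opening the center `u l` collects a contribution of exactly `n * w`
from the sample `u`, provided that no point of the sample lies farther from `u l` than the price. -/
noncomputable def dualPrice (w : ℝ) (u : Fin n → E) (l : Fin n) : ℝ :=
  w + totalDist u (u l) / n

/-- The properties of the sample of a single ball, centered at the origin, that hold with high
probability and entail exact recovery. In the application `g` is the population version of
`sampleContribution b u`, and `K` is a compact set. -/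
structure IsTypicalSample (g : E → ℝ) (K : Set E) (b η : ℝ) (u : Fin n → E) : Prop where
  norm_le_one : ∀ l, ‖u l‖ ≤ 1
  exists_norm_le : ∃ l, ‖u l‖ ≤ η
  abs_sub_le : ∀ x ∈ K, |sampleContribution b u x - n * g x| ≤ n * η
  totalDist_injective : Function.Injective fun l => totalDist u (u l)

theorem mul_dualPrice (w : ℝ) (u : Fin n → E) (l : Fin n) :
    n * dualPrice w u l = n * w + totalDist u (u l) := by
  have hn : (n : ℝ) ≠ 0 := Nat.cast_ne_zero.2 (Fin.pos l).ne'
  rw [dualPrice, mul_add, mul_div_cancel₀ _ hn]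

namespace IsTypicalSample

theorem sub_le_dualPrice (h : IsTypicalSample g K b η u) (hK : Metric.closedBall 0 1 ⊆ K)
    (hg : ∀ x, g x ≤ g 0) (l : Fin n) : b - η ≤ dualPrice (g 0) u l := by
  have hn : (0 : ℝ) < n := Nat.cast_pos.2 (Fin.pos l)
  refine le_of_mul_le_mul_left ?_ hn
  have happrox := (abs_le.1 (h.abs_sub_le (u l) (hK (by simpa using h.norm_le_one l)))).2
  have hlower := card_mul_sub_totalDist_le_sampleContribution (a := b) (u := u) (x := u l)
  have hmax := mul_le_mul_of_nonneg_left (hg (u l)) hn.le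
  rw [Fintype.card_fin] at hlower
  rw [mul_dualPrice, mul_sub]
  linarith

theorem dualPrice_le (h : IsTypicalSample g K b η u) (hK : 0 ∈ K) (hb : 1 ≤ b)
    (hl : IsMedoid u l) : dualPrice (g 0) u l ≤ b + 2 * η := by
  obtain ⟨l₀, hl₀⟩ := h.exists_norm_le
  refine le_of_mul_le_mul_left ?_ (Nat.cast_pos.2 (Fin.pos l) : (0 : ℝ) < n)
  have horigin : sampleContribution b u 0 = n * b - totalDist u 0 := by
    rw [sampleContribution_eq_of_forall_norm_sub_le, Fintype.card_fin]
    exact fun l => by simpa using (h.norm_le_one l).trans hb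
  have happrox := (abs_le.1 (h.abs_sub_le 0 hK)).1
  have hnear : totalDist u (u l₀) ≤ n * η + totalDist u 0 := by
    calc totalDist u (u l₀) ≤ ∑ l', (η + ‖0 - u l'‖) := Finset.sum_le_sum fun l' _ => by
          simpa using (norm_sub_le (u l₀) (u l')).trans (add_le_add_left hl₀ _)
      _ = n * η + totalDist u 0 := by simp [totalDist, Finset.sum_add_distrib]
  rw [mul_dualPrice, mul_add]
  linarith [hl l₀]

theorem nonneg (h : IsTypicalSample g K b η u) : 0 ≤ η :=
  h.exists_norm_le.elim fun _ hl => (norm_nonneg _).trans hl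

theorem sampleContribution_le (h : IsTypicalSample g K b η u) {a : ℝ} {x : E}
    (ha : a ≤ b + 2 * η) (hx : x ∈ K) : sampleContribution a u x ≤ n * (g x + 3 * η) := by
  have hprice := sampleContribution_le_add (u := u) (x := x) (mul_nonneg zero_le_two h.nonneg) ha
  have happrox := (abs_le.1 (h.abs_sub_le x hx)).2
  rw [Fintype.card_fin] at hprice
  linarith

theorem exists_isMedoid (h : IsTypicalSample g K b η u) : ∃ l, IsMedoid u l :=
  have : Nonempty (Fin n) := h.exists_norm_le.nonempty
  Finite.exists_min fun l => totalDist u (u l)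

end IsTypicalSample

end TypicalSample

section BallModel

variable {E : Type*} [SeminormedAddCommGroup E] {k n : ℕ} {c : Fin k → E} {v : Fin k × Fin n → E}
  {a : Fin k → ℝ} {p q : Fin k × Fin n} {ε : ℝ}

/-- The distances between the points `c i + v (i, l)` of the stochastic ball model. -/
def ballDist (c : Fin k → E) (v : Fin k × Fin n → E) (p q : Fin k × Fin n) : ℝ :=
  dist (c p.1 + v p) (c q.1 + v q)

theorem ballDist_eq_norm (p q : Fin k × Fin n) :
    ballDist c v p q = ‖c p.1 - c q.1 + v p - v q‖ := by
  rw [ballDist, dist_eq_norm]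
  congr 1
  abel

theorem ballDist_eq_norm_of_fst_eq (h : q.1 = p.1) : ballDist c v p q = ‖v p - v q‖ := by
  rw [ballDist_eq_norm, h, sub_self, zero_add]

theorem dist_sub_norm_sub_norm_le_ballDist (p q : Fin k × Fin n) :
    dist (c p.1) (c q.1) - ‖v p‖ - ‖v q‖ ≤ ballDist c v p q := by
  have htriangle := dist_triangle4 (c p.1) (c p.1 + v p) (c q.1 + v q) (c q.1)
  rw [dist_self_add_right, dist_self_add_left] at htriangle
  rw [ballDist]
  linarith

theorem contribution_ballDist (p : Fin k × Fin n) :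
    contribution (ballDist c v) (fun q => a q.1) p =
      ∑ j, sampleContribution (a j) (Function.curry v j) (c p.1 - c j + v p) := by
  simp only [contribution, sampleContribution, Fintype.sum_prod_type, ballDist_eq_norm,
    Function.curry_apply]

theorem ballDist_le_price (ha : 1 + ε ≤ a q.1) (hp : ‖v p‖ < ε) (hq : ‖v q‖ ≤ 1)
    (hqp : q.1 = p.1) : ballDist c v p q ≤ a q.1 := by
  rw [ballDist_eq_norm_of_fst_eq hqp]
  linarith [norm_sub_le (v p) (v q)]

theorem price_lt_ballDist (hsep : ∀ i j, i ≠ j → 2 + 4 * ε ≤ dist (c i) (c j))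
    (ha : a q.1 ≤ 1 + 3 * ε) (hp : ‖v p‖ < ε) (hq : ‖v q‖ ≤ 1) (hqp : q.1 ≠ p.1) :
    a q.1 < ballDist c v p q := by
  linarith [dist_sub_norm_sub_norm_le_ballDist (c := c) (v := v) p q, hsep _ _ hqp.symm]

theorem contribution_eq_of_norm_lt (hsep : ∀ i j, i ≠ j → 2 + 4 * ε ≤ dist (c i) (c j))
    (hv : ∀ q, ‖v q‖ ≤ 1) (ha : ∀ j, 1 + ε ≤ a j) (ha' : ∀ j, a j ≤ 1 + 3 * ε) {i : Fin k}
    {l : Fin n} (hil : ‖v (i, l)‖ < ε) :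
    contribution (ballDist c v) (fun q => a q.1) (i, l) =
      n * a i - totalDist (Function.curry v i) (v (i, l)) := by
  rw [contribution_ballDist, Fintype.sum_eq_single i, sub_self, zero_add,
    sampleContribution_eq_of_forall_norm_sub_le, Fintype.card_fin]
  · intro l'
    rw [Function.curry_apply,
      ← ballDist_eq_norm_of_fst_eq (c := c) (p := (i, l)) (q := (i, l')) rfl]
    exact ballDist_le_price (ha _) hil (hv _) rfl
  · intro j hj
    refine sampleContribution_eq_zero fun l' => ?_
    have hlt := price_lt_ballDist (a := a) (p := (i, l)) (q := (j, l')) hsep (ha' j) hil (hv _) hj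
    exact (ballDist_eq_norm (c := c) (v := v) (i, l) (j, l') ▸ hlt).le

variable {g : E → ℝ} {K : Set E} {b η γ : ℝ}

theorem contribution_lt_of_gap (hK : ∀ i j, Metric.closedBall (c i - c j) 1 ⊆ K)
    (hgap : ∀ i x, ‖x‖ ≤ 1 → ε ≤ ‖x‖ → ∑ j, g (c i - c j + x) ≤ g 0 - γ)
    (hγ : 3 * k * η < γ) (htyp : ∀ j, IsTypicalSample g K b η (Function.curry v j))
    (ha : ∀ j, a j ≤ b + 2 * η) {i : Fin k} {l : Fin n} (hil : ε ≤ ‖v (i, l)‖) :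
    contribution (ballDist c v) (fun q => a q.1) (i, l) < n * g 0 := by
  have hnorm : ‖v (i, l)‖ ≤ 1 := (htyp i).norm_le_one l
  rw [contribution_ballDist]
  calc ∑ j, sampleContribution (a j) (Function.curry v j) (c i - c j + v (i, l))
      ≤ ∑ j, n * (g (c i - c j + v (i, l)) + 3 * η) := Finset.sum_le_sum fun j _ =>
        (htyp j).sampleContribution_le (ha j) (hK i j (by
          rwa [mem_closedBall_iff_norm, add_sub_cancel_left]))
    _ = n * (∑ j, g (c i - c j + v (i, l)) + 3 * k * η) := by
        rw [← Finset.mul_sum, Finset.sum_add_distrib, Finset.sum_const, Finset.card_univ,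
          Fintype.card_fin, nsmul_eq_mul]
        ring
    _ < n * g 0 := by
        have hn : (0 : ℝ) < n := Nat.cast_pos.2 (Fin.pos l)
        gcongr
        linarith [hgap i _ hnorm hil]

theorem norm_lt_of_eq_dualPrice_of_gap (hK : ∀ i j, Metric.closedBall (c i - c j) 1 ⊆ K)
    (hgap : ∀ i x, ‖x‖ ≤ 1 → ε ≤ ‖x‖ → ∑ j, g (c i - c j + x) ≤ g 0 - γ)
    (hγ : 3 * k * η < γ) (htyp : ∀ j, IsTypicalSample g K b η (Function.curry v j))
    (ha : ∀ j, a j ≤ b + 2 * η) {i : Fin k} {l : Fin n}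
    (hil : a i = dualPrice (g 0) (Function.curry v i) l) : ‖v (i, l)‖ < ε := by
  by_contra! hfar
  refine (contribution_lt_of_gap hK hgap hγ htyp ha hfar).not_ge ?_
  rw [contribution_ballDist]
  calc n * g 0 = n * a i - totalDist (Function.curry v i) (v (i, l)) := by
        rw [hil, mul_dualPrice, Function.curry_apply, add_sub_cancel_right]
    _ ≤ sampleContribution (a i) (Function.curry v i) (c i - c i + v (i, l)) := by
        rw [sub_self, zero_add]
        simpa using card_mul_sub_totalDist_le_sampleContribution (u := Function.curry v i)
    _ ≤ ∑ j, sampleContribution (a j) (Function.curry v j) (c i - c j + v (i, l)) :=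
        Finset.single_le_sum (f := fun j =>
          sampleContribution (a j) (Function.curry v j) (c i - c j + v (i, l)))
          (fun _ _ => sampleContribution_nonneg) (Finset.mem_univ i)

theorem isDualCertificate_of_isMedoid {s : Fin k → Fin n} {w : ℝ}
    (hsep : ∀ i j, i ≠ j → 2 + 4 * ε ≤ dist (c i) (c j)) (hv : ∀ q, ‖v q‖ ≤ 1)
    (hinj : ∀ i, Function.Injective fun l => totalDist (Function.curry v i) (v (i, l)))
    (hs : ∀ i, IsMedoid (Function.curry v i) (s i)) (hs_near : ∀ i, ‖v (i, s i)‖ < ε)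
    (has : ∀ i, a i = dualPrice w (Function.curry v i) (s i)) (ha : ∀ i, 1 + ε ≤ a i)
    (ha' : ∀ i, a i ≤ 1 + 3 * ε)
    (hfar : ∀ i l, ε ≤ ‖v (i, l)‖ →
      contribution (ballDist c v) (fun q => a q.1) (i, l) < n * w) :
    IsDualCertificate (ballDist c v) Prod.fst (fun i => (i, s i)) (fun q => a q.1) (n * w) := by
  have hnear : ∀ {i l}, ‖v (i, l)‖ < ε →
      contribution (ballDist c v) (fun q => a q.1) (i, l) =
        n * w + totalDist (Function.curry v i) (v (i, s i)) -
          totalDist (Function.curry v i) (v (i, l)) := fun {i l} hil => by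
    rw [contribution_eq_of_norm_lt hsep hv ha ha' hil, has, mul_dualPrice, Function.curry_apply]
  refine ⟨fun _ => rfl, fun q => ballDist_le_price (ha _) (hs_near _) (hv q) rfl,
    fun i q hi => price_lt_ballDist hsep (ha' _) (hs_near i) (hv q) hi,
    fun i => by rw [hnear (hs_near i), add_sub_cancel_right], ?_⟩
  rintro ⟨i, l⟩ hil
  rcases lt_or_ge ‖v (i, l)‖ ε with hlt | hge
  · have hne : s i ≠ l := fun h => hil ⟨i, congrArg (Prod.mk i) h⟩
    have htotal : totalDist (Function.curry v i) (v (i, s i)) <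
        totalDist (Function.curry v i) (v (i, l)) := (hs i l).lt_of_ne ((hinj i).ne hne)
    linarith [hnear hlt]
  · exact hfar i l hge

theorem exactRecovery_of_isTypicalSample (hη : 2 * η ≤ ε) (hγ : 3 * k * η < γ)
    (hsep : ∀ i j, i ≠ j → 2 + 4 * ε ≤ dist (c i) (c j))
    (hK : ∀ i j, Metric.closedBall (c i - c j) 1 ⊆ K) (hg : ∀ x, g x ≤ g 0)
    (hgap : ∀ i x, ‖x‖ ≤ 1 → ε ≤ ‖x‖ → ∑ j, g (c i - c j + x) ≤ g 0 - γ)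
    (htyp : ∀ i, IsTypicalSample g K (1 + 2 * ε) η (Function.curry v i)) :
    ExactRecovery (ballDist c v) Prod.fst := by
  have hball : ∀ i : Fin k, Metric.closedBall 0 1 ⊆ K := fun i => by simpa using hK i i
  choose s hs using fun i => (htyp i).exists_isMedoid
  set a : Fin k → ℝ := fun i => dualPrice (g 0) (Function.curry v i) (s i)
  have hη0 : Fin k → 0 ≤ η := fun i => (htyp i).nonneg
  have ha_ge : ∀ i, 1 + ε ≤ a i := fun i => by
    linarith [(htyp i).sub_le_dualPrice (hball i) hg (s i), hη0 i]
  have ha_le : ∀ i, a i ≤ 1 + 2 * ε + 2 * η := fun i =>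
    (htyp i).dualPrice_le (hball i (by simp)) (by linarith [hη0 i]) (hs i)
  have ha_le' : ∀ i, a i ≤ 1 + 3 * ε := fun i => by linarith [ha_le i]
  have hs_near : ∀ i, ‖v (i, s i)‖ < ε := fun i =>
    norm_lt_of_eq_dualPrice_of_gap hK hgap hγ htyp ha_le rfl
  exact (isDualCertificate_of_isMedoid hsep (fun q => (htyp q.1).norm_le_one q.2)
    (fun i => (htyp i).totalDist_injective) hs hs_near (fun _ => rfl) ha_ge
    ha_le' fun _ _ => contribution_lt_of_gap hK hgap hγ htyp ha_le).exactRecovery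

end BallModel

open Metric Set
open scoped ENNReal

section MeanContribution

variable {E : Type*} [SeminormedAddCommGroup E] [MeasurableSpace E]

/-- The expected contribution `E (α - ‖x - v‖)⁺` of the position `x` when the points `v` of a ball
centered at the origin are drawn from `μ` and have dual price `α`. -/
noncomputable def meanContribution (μ : Measure E) (α : ℝ) (x : E) : ℝ :=
  ∫ v, max (α - ‖x - v‖) 0 ∂μ

theorem meanContribution_nonneg (μ : Measure E) (α : ℝ) (x : E) : 0 ≤ meanContribution μ α x :=
  integral_nonneg fun _ => le_max_right _ _

theorem abs_max_sub_norm_sub_le {F : Type*} [SeminormedAddCommGroup F] (α : ℝ) (x y v : F) :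
    |max (α - ‖x - v‖) 0 - max (α - ‖y - v‖) 0| ≤ ‖x - y‖ := by
  refine (abs_max_sub_max_le_abs _ _ _).trans ?_
  rw [sub_sub_sub_cancel_left, norm_sub_rev x y]
  exact (abs_norm_sub_norm_le _ _).trans (by simp)

theorem measurable_measure_ball_sub (μ : Measure E) (α : ℝ) (x : E) :
    Measurable fun t : ℝ => μ (ball x (α - t)) :=
  Antitone.measurable fun _ _ h => measure_mono (ball_subset_ball (by linarith))

variable [OpensMeasurableSpace E]

theorem measurable_max_sub_norm_sub (α : ℝ) (x : E) : Measurable fun v => max (α - ‖x - v‖) 0 :=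
  (by fun_prop : Continuous fun v => max (α - ‖x - v‖) 0).measurable

theorem lintegral_max_sub_norm_sub (μ : Measure E) (α : ℝ) (x : E) :
    ∫⁻ v, ENNReal.ofReal (max (α - ‖x - v‖) 0) ∂μ = ∫⁻ t in Ioi (0 : ℝ), μ (ball x (α - t)) := by
  rw [lintegral_eq_lintegral_meas_lt μ (f := fun v => max (α - ‖x - v‖) 0)
    (ae_of_all _ fun _ => le_max_right _ _)
    (measurable_max_sub_norm_sub α x).aemeasurable]
  refine setLIntegral_congr_fun measurableSet_Ioi fun t ht => congrArg μ (ext fun v => ?_)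
  simp only [mem_ofPred_eq, lt_max_iff, (mem_Ioi.1 ht).not_gt, or_false, mem_ball', dist_eq_norm,
    lt_sub_comm]

variable (μ : Measure E) [IsFiniteMeasure μ] (α : ℝ)

theorem memLp_max_sub_norm_sub (x : E) (q : ℝ≥0∞) : MemLp (fun v => max (α - ‖x - v‖) 0) q μ := by
  refine MemLp.of_bound (measurable_max_sub_norm_sub α x).aestronglyMeasurable |α|
    (ae_of_all _ fun v => ?_)
  rw [Real.norm_of_nonneg (le_max_right _ _)]
  exact max_le (by linarith [le_abs_self α, norm_nonneg (x - v)]) (abs_nonneg _)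

theorem integrable_max_sub_norm_sub (x : E) : Integrable (fun v => max (α - ‖x - v‖) 0) μ :=
  (memLp_max_sub_norm_sub μ α x 1).integrable le_rfl

theorem abs_meanContribution_sub_le (x y : E) :
    |meanContribution μ α x - meanContribution μ α y| ≤ μ.real univ * ‖x - y‖ := by
  unfold meanContribution
  rw [← integral_sub (integrable_max_sub_norm_sub μ α x) (integrable_max_sub_norm_sub μ α y),
    ← Real.norm_eq_abs, mul_comm]
  exact norm_integral_le_of_norm_le_const
    (ae_of_all _ fun v => (Real.norm_eq_abs _).trans_le (abs_max_sub_norm_sub_le α x y v))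

theorem continuous_meanContribution : Continuous (meanContribution μ α) :=
  (LipschitzWith.of_dist_le_mul (K := ⟨μ.real univ, measureReal_nonneg⟩) fun x y => by
    rw [Real.dist_eq, dist_eq_norm]
    exact abs_meanContribution_sub_le μ α x y).continuous

theorem ofReal_meanContribution (x : E) :
    ENNReal.ofReal (meanContribution μ α x) = ∫⁻ t in Ioi (0 : ℝ), μ (ball x (α - t)) := by
  rw [← lintegral_max_sub_norm_sub, meanContribution, ofReal_integral_eq_lintegral_ofReal
    (integrable_max_sub_norm_sub μ α x) (ae_of_all _ fun _ => le_max_right _ _)]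

theorem ofReal_sum_meanContribution {ι : Type*} [Fintype ι] (x : ι → E) :
    ENNReal.ofReal (∑ i, meanContribution μ α (x i)) =
      ∫⁻ t in Ioi (0 : ℝ), ∑ i, μ (ball (x i) (α - t)) := by
  rw [ENNReal.ofReal_sum_of_nonneg fun i _ => meanContribution_nonneg μ α (x i),
    lintegral_finsetSum _ fun i _ => measurable_measure_ball_sub μ α (x i)]
  exact Finset.sum_congr rfl fun i _ => ofReal_meanContribution μ α (x i)

end MeanContribution

section RadialDensity

variable {E R : Type*} [Norm E] [Preorder R]

/-- `p` is radially nonincreasing on `B`. -/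
def RadiallyAntitoneOn (p : E → R) (B : Set E) : Prop :=
  ∀ x₁ ∈ B, ∀ x₂ ∈ B, ‖x₁‖ < ‖x₂‖ → p x₂ ≤ p x₁

/-- `p` is radially decreasing on `B`, which is the assumption on the density of `μ`. -/
def RadiallyStrictAntiOn (p : E → R) (B : Set E) : Prop :=
  ∀ x₁ ∈ B, ∀ x₂ ∈ B, ‖x₁‖ < ‖x₂‖ → p x₂ < p x₁

theorem RadiallyStrictAntiOn.radiallyAntitoneOn {p : E → R} {B : Set E}
    (h : RadiallyStrictAntiOn p B) : RadiallyAntitoneOn p B :=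
  fun x₁ hx₁ x₂ hx₂ hlt => (h x₁ hx₁ x₂ hx₂ hlt).le

end RadialDensity

section Bathtub

variable {X : Type*} [MeasurableSpace X] {ν : Measure X} {U D : Set X} {p : X → ℝ≥0∞} {τ : ℝ≥0∞}

theorem setLIntegral_le_mul_measure (hU : MeasurableSet U) (hp : ∀ x ∈ U, p x ≤ τ) :
    ∫⁻ x in U, p x ∂ν ≤ τ * ν U :=
  (setLIntegral_mono' hU hp).trans_eq (setLIntegral_const U τ)

theorem mul_measure_le_setLIntegral (hU : MeasurableSet U) (hp : ∀ x ∈ U, τ ≤ p x) :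
    τ * ν U ≤ ∫⁻ x in U, p x ∂ν :=
  (setLIntegral_const U τ).symm.trans_le (setLIntegral_mono' hU hp)

theorem setLIntegral_le_setLIntegral_of_measure_le (hU : MeasurableSet U) (hD : MeasurableSet D)
    (hfin : ν U ≠ ∞) (hUD : ν U ≤ ν D) (hpU : ∀ x ∈ U \ D, p x ≤ τ) (hpD : ∀ x ∈ D \ U, τ ≤ p x) :
    ∫⁻ x in U, p x ∂ν ≤ ∫⁻ x in D, p x ∂ν := by
  have hdiff : ν (U \ D) ≤ ν (D \ U) := by
    rw [← measure_inter_add_sdiff U hD, ← measure_inter_add_sdiff D hU, inter_comm D U] at hUD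
    exact (ENNReal.add_le_add_iff_left (measure_ne_top_of_subset inter_subset_left hfin)).1 hUD
  rw [← lintegral_inter_add_sdiff p U hD, ← lintegral_inter_add_sdiff p D hU, inter_comm D U]
  gcongr 1
  calc ∫⁻ x in U \ D, p x ∂ν ≤ τ * ν (U \ D) := setLIntegral_le_mul_measure (hU.diff hD) hpU
    _ ≤ τ * ν (D \ U) := by gcongr
    _ ≤ ∫⁻ x in D \ U, p x ∂ν := mul_measure_le_setLIntegral (hD.diff hU) hpD

end Bathtub

section SeparatedBalls

variable {E : Type*} [NormedAddCommGroup E] {ι : Type*} {x : ι → E} {s r : ℝ}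

theorem pairwise_disjoint_ball_inter (hs : Pairwise fun i j => 2 * s ≤ dist (x i) (x j))
    (B : Set E) : Pairwise (Function.onFun Disjoint fun i => ball (x i) s ∩ B) :=
  fun _ _ hij => (ball_disjoint_ball (by linarith [hs hij])).mono inter_subset_left
    inter_subset_left

variable [MeasurableSpace E] [BorelSpace E] [Fintype ι]

theorem sum_measure_ball_inter_closedBall_le (ν : Measure E) [ν.IsAddLeftInvariant]
    (hs : Pairwise fun i j => 2 * s ≤ dist (x i) (x j))
    (hr : Pairwise fun i j => 2 * r < dist (x i) (x j)) :
    ∑ i, ν (ball (x i) s ∩ closedBall 0 r) ≤ ν (ball 0 s ∩ closedBall 0 r) := by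
  rcases lt_or_ge r s with hrs | hsr
  · rw [← tsum_fintype (L := .unconditional ι),
      ← measure_iUnion (pairwise_disjoint_ball_inter hs _)
        fun _ => measurableSet_ball.inter measurableSet_closedBall]
    exact measure_mono (iUnion_subset fun i => subset_inter
      (inter_subset_right.trans (closedBall_subset_ball hrs)) inter_subset_right)
  · have htranslate : ∀ i, ν (ball (x i) s ∩ closedBall 0 r) =
        ν (ball 0 s ∩ closedBall (-x i) r) := fun i => by
      rw [← measure_preimage_add ν (x i), preimage_inter, preimage_add_ball,
        preimage_add_closedBall, sub_self, zero_sub]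
    have hdisjoint : Pairwise (Function.onFun Disjoint fun i => ball 0 s ∩ closedBall (-x i) r) :=
      fun i j hij => (closedBall_disjoint_closedBall
        (by rw [dist_neg_neg]; linarith [hr hij])).mono inter_subset_right inter_subset_right
    simp only [htranslate]
    rw [← tsum_fintype (L := .unconditional ι), ← measure_iUnion hdisjoint
      fun _ => measurableSet_ball.inter measurableSet_closedBall]
    exact measure_mono (iUnion_subset fun i => subset_inter inter_subset_left
      (inter_subset_left.trans (ball_subset_closedBall.trans (closedBall_subset_closedBall hsr))))

/-- Bathtub principle: on the central ball the density exceeds its values at all other points, and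
this ball is at least as large as the other balls taken together. -/
theorem sum_setLIntegral_ball_le (ν : Measure E) [ν.IsAddLeftInvariant]
    (hν : ν (ball 0 s ∩ closedBall 0 r) ≠ ∞) {p : E → ℝ≥0∞}
    (hp : RadiallyAntitoneOn p (closedBall 0 r))
    (hs : Pairwise fun i j => 2 * s ≤ dist (x i) (x j))
    (hr : Pairwise fun i j => 2 * r < dist (x i) (x j)) :
    ∑ i, ∫⁻ v in ball (x i) s ∩ closedBall 0 r, p v ∂ν ≤
      ∫⁻ v in ball 0 s ∩ closedBall 0 r, p v ∂ν := by
  have hmeas : ∀ y, MeasurableSet (ball y s ∩ closedBall (0 : E) r) := fun _ =>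
    measurableSet_ball.inter measurableSet_closedBall
  have hdisjoint := pairwise_disjoint_ball_inter hs (closedBall 0 r)
  have hvolume : ν (⋃ i, ball (x i) s ∩ closedBall 0 r) ≤ ν (ball 0 s ∩ closedBall 0 r) := by
    rw [measure_iUnion hdisjoint fun i => hmeas (x i), tsum_fintype]
    exact sum_measure_ball_inter_closedBall_le ν hs hr
  rw [← tsum_fintype (L := .unconditional ι), ← lintegral_iUnion (fun i => hmeas (x i)) hdisjoint]
  refine setLIntegral_le_setLIntegral_of_measure_le (MeasurableSet.iUnion fun i => hmeas (x i))
    (hmeas 0) (ne_top_of_le_ne_top hν hvolume) hvolume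
    (τ := ⨅ y ∈ ball 0 s ∩ closedBall 0 r, p y) (fun v hv => le_iInf₂ fun y hy => ?_)
    fun v hv => iInf₂_le v hv.1
  obtain ⟨i, hvi⟩ := mem_iUnion.1 hv.1
  have hsv : s ≤ ‖v‖ := by
    by_contra! h
    exact hv.2 ⟨mem_ball_zero_iff.2 h, hvi.2⟩
  exact hp y hy.2 v hvi.2 ((mem_ball_zero_iff.1 hy.1).trans_le hsv)

end SeparatedBalls

section StrictlySeparatedBalls

variable {E : Type*} [NormedAddCommGroup E] [NormedSpace ℝ E] [Nontrivial E] [MeasurableSpace E]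
  [BorelSpace E] [ProperSpace E] {ι : Type*} [Fintype ι] {x : ι → E} {s r : ℝ}

theorem sum_setLIntegral_ball_lt (ν : Measure E) [ν.IsAddHaarMeasure] {p : E → ℝ≥0∞}
    (hpm : Measurable p) (hp : RadiallyStrictAntiOn p (closedBall 0 r)) (hs0 : 0 < s)
    (hsr : s ≤ r) (hx : ∀ i, 2 * s ≤ ‖x i‖)
    (hs : Pairwise fun i j => 2 * s ≤ dist (x i) (x j))
    (hr : Pairwise fun i j => 2 * r < dist (x i) (x j)) :
    ∑ i, ∫⁻ v in ball (x i) s ∩ closedBall 0 r, p v ∂ν <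
      ∫⁻ v in ball 0 s ∩ closedBall 0 r, p v ∂ν := by
  obtain ⟨y, hy⟩ := exists_norm_eq E hs0.le
  have hyr : y ∈ closedBall 0 r := mem_closedBall_zero_iff.2 (hy.trans_le hsr)
  have houter : ∀ i, ∀ v ∈ ball (x i) s ∩ closedBall 0 r, p v ≤ p y := by
    intro i v hv
    refine (hp y hyr v hv.2 ?_).le
    linarith [hx i, norm_le_norm_add_norm_sub v (x i), mem_ball_iff_norm.1 hv.1]
  have hcentral : ball 0 s ∩ closedBall 0 r = ball (0 : E) s :=
    inter_eq_left.2 (ball_subset_closedBall.trans (closedBall_subset_closedBall hsr))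
  have hinner : ∀ v ∈ ball 0 s, p y < p v := fun v hv =>
    hp v (hcentral.symm.subset hv).2 y hyr (hy.symm ▸ mem_ball_zero_iff.1 hv)
  have hpy : p y ≠ ∞ := (hinner 0 (mem_ball_self hs0)).ne_top
  calc ∑ i, ∫⁻ v in ball (x i) s ∩ closedBall 0 r, p v ∂ν
      ≤ ∑ i, p y * ν (ball (x i) s ∩ closedBall 0 r) := Finset.sum_le_sum fun i _ =>
        setLIntegral_le_mul_measure (measurableSet_ball.inter measurableSet_closedBall) (houter i)
    _ ≤ p y * ν (ball 0 s) := by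
        rw [← Finset.mul_sum, ← hcentral]
        gcongr
        exact sum_measure_ball_inter_closedBall_le ν hs hr
    _ = ∫⁻ _ in ball 0 s, p y ∂ν := (setLIntegral_const _ _).symm
    _ < ∫⁻ v in ball 0 s, p v ∂ν :=
        setLIntegral_strict_mono measurableSet_ball (measure_ball_pos ν 0 hs0).ne' hpm
          (by rw [setLIntegral_const]; exact ENNReal.mul_ne_top hpy measure_ball_lt_top.ne)
          (ae_of_all _ hinner)
    _ = ∫⁻ v in ball 0 s ∩ closedBall 0 r, p v ∂ν := by rw [hcentral]

end StrictlySeparatedBalls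

section Gap

variable {E : Type*} [NormedAddCommGroup E] [MeasurableSpace E] [BorelSpace E] {ν μ : Measure E}
  {p : E → ℝ≥0∞} {r α ε : ℝ}

theorem measure_ball_eq_setLIntegral
    (hμ : μ = (ν.restrict (closedBall 0 r)).withDensity p) (y : E) (s : ℝ) :
    μ (ball y s) = ∫⁻ v in ball y s ∩ closedBall 0 r, p v ∂ν := by
  rw [hμ, withDensity_apply _ measurableSet_ball, Measure.restrict_restrict measurableSet_ball]

variable [NormedSpace ℝ E] [Nontrivial E] [ProperSpace E] [ν.IsAddHaarMeasure]

theorem measure_closedBall_zero_pos (hpm : Measurable p)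
    (hp : RadiallyStrictAntiOn p (closedBall 0 r))
    (hμ : μ = (ν.restrict (closedBall 0 r)).withDensity p) (hr : 0 < r) (hε : 0 < ε) :
    0 < μ (closedBall 0 ε) := by
  -- The comparison with no further balls says that the central one has positive measure.
  have hpos := sum_setLIntegral_ball_lt ν (x := (Empty.elim : Empty → E)) hpm hp (lt_min hε hr)
    (min_le_right _ _) (fun i => i.elim) (fun i => i.elim) fun i => i.elim
  rw [Finset.sum_of_isEmpty, ← measure_ball_eq_setLIntegral hμ] at hpos
  exact hpos.trans_le (measure_mono
    (ball_subset_closedBall.trans (closedBall_subset_closedBall (min_le_left _ _))))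

variable {ι : Type*} [Fintype ι] [IsFiniteMeasure μ]

theorem sum_meanContribution_lt (hpm : Measurable p)
    (hp : RadiallyStrictAntiOn p (closedBall 0 r))
    (hμ : μ = (ν.restrict (closedBall 0 r)).withDensity p) (hr0 : 0 < r) (hα : 0 < α) {x : ι → E}
    (hx : ∀ i, x i ≠ 0) (hs : Pairwise fun i j => 2 * α ≤ dist (x i) (x j))
    (hr : Pairwise fun i j => 2 * r < dist (x i) (x j)) :
    ∑ i, meanContribution μ α (x i) < meanContribution μ α 0 := by
  have hle : ∀ t ∈ Ioi (0 : ℝ), ∑ i, μ (ball (x i) (α - t)) ≤ μ (ball 0 (α - t)) := by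
    intro t ht
    simp only [measure_ball_eq_setLIntegral hμ]
    refine sum_setLIntegral_ball_le ν
      (measure_ne_top_of_subset inter_subset_left measure_ball_lt_top.ne)
      hp.radiallyAntitoneOn (fun i j hij => ?_) hr
    linarith [hs hij, mem_Ioi.1 ht]
  obtain ⟨δ, hδ0, hδα, hδr, hδx⟩ : ∃ δ > 0, δ ≤ α ∧ δ ≤ r ∧ ∀ i, 2 * δ ≤ ‖x i‖ := by
    obtain ⟨ρ, hρ, hρx⟩ := Pi.exists_forall_pos_add_lt fun i => norm_pos_iff.2 (hx i)
    refine ⟨min (ρ / 2) (min α r), by positivity, by simp, by simp, fun i => ?_⟩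
    linarith [hρx i, min_le_left (ρ / 2) (min α r)]
  have hlt : ∀ t ∈ Ioo (α - δ) α, ∑ i, μ (ball (x i) (α - t)) < μ (ball 0 (α - t)) := by
    rintro t ⟨ht, htα⟩
    simp only [measure_ball_eq_setLIntegral hμ]
    exact sum_setLIntegral_ball_lt ν hpm hp (by linarith) (by linarith)
      (fun i => by linarith [hδx i]) (fun i j hij => by linarith [hs hij]) hr
  refine (ENNReal.ofReal_lt_ofReal_iff_of_nonneg
    (Finset.sum_nonneg fun i _ => meanContribution_nonneg μ α (x i))).1 ?_
  have hfin := ENNReal.ofReal_ne_top (r := ∑ i, meanContribution μ α (x i))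
  rw [ofReal_sum_meanContribution] at hfin ⊢
  rw [ofReal_meanContribution]
  refine lintegral_strict_mono_of_ae_le_of_ae_lt_on (measurable_measure_ball_sub μ α 0).aemeasurable
    hfin ((ae_restrict_mem measurableSet_Ioi).mono hle) ?_ (ae_of_all _ hlt)
  rw [Measure.restrict_apply measurableSet_Ioo, inter_eq_left.2 fun t ht => ?_]
  · simp [hδ0]
  · rw [mem_Ioi]
    linarith [ht.1]

theorem meanContribution_le_meanContribution_zero (hpm : Measurable p)
    (hp : RadiallyStrictAntiOn p (closedBall 0 r))
    (hμ : μ = (ν.restrict (closedBall 0 r)).withDensity p) (hr0 : 0 < r) (hα : 0 < α) (x : E) :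
    meanContribution μ α x ≤ meanContribution μ α 0 := by
  rcases eq_or_ne x 0 with rfl | hx
  · exact le_rfl
  · simpa using (sum_meanContribution_lt hpm hp hμ hr0 hα (x := fun _ : Unit => x) (fun _ => hx)
      (Subsingleton.pairwise) (Subsingleton.pairwise)).le

theorem exists_gap_sum_meanContribution (hpm : Measurable p)
    (hp : RadiallyStrictAntiOn p (closedBall 0 r))
    (hμ : μ = (ν.restrict (closedBall 0 r)).withDensity p) (hr0 : 0 < r) (hrα : r < α) {c : ι → E}
    (hs : Pairwise fun i j => 2 * α ≤ dist (c i) (c j)) (hε : 0 < ε) :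
    ∃ γ > 0, ∀ i x, ‖x‖ ≤ r → ε ≤ ‖x‖ →
      ∑ j, meanContribution μ α (c i - c j + x) ≤ meanContribution μ α 0 - γ := by
  have hlt : ∀ i, ∀ x ∈ closedBall 0 r ∩ {x : E | ε ≤ ‖x‖},
      ∑ j, meanContribution μ α (c i - c j + x) < meanContribution μ α 0 := by
    rintro i x ⟨hxr, hεx⟩
    rw [mem_closedBall_zero_iff] at hxr
    have hdist : ∀ j l, dist (c i - c j + x) (c i - c l + x) = dist (c j) (c l) := fun j l => by
      rw [dist_add_right, dist_sub_left]
    refine sum_meanContribution_lt hpm hp hμ hr0 (hr0.trans hrα) (fun j hj => ?_)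
      (fun j l hjl => (hs hjl).trans_eq (hdist j l).symm)
      fun j l hjl => by linarith [hs hjl, hdist j l]
    rcases eq_or_ne i j with rfl | hij
    · rw [sub_self, zero_add] at hj
      linarith [hε.trans_le hεx, norm_eq_zero.2 hj]
    · have hnorm : dist (c i) (c j) = ‖x‖ := by
        rw [dist_eq_norm, eq_neg_of_add_eq_zero_left hj, norm_neg]
      linarith [hs hij]
  have hcompact : IsCompact (closedBall 0 r ∩ {x : E | ε ≤ ‖x‖}) :=
    (isCompact_closedBall 0 r).inter_right (isClosed_le continuous_const continuous_norm)
  have hcont : ∀ i, Continuous fun x => ∑ j, meanContribution μ α (c i - c j + x) := fun i =>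
    continuous_finsetSum _ fun j _ =>
      (continuous_meanContribution μ α).comp (continuous_const.add continuous_id)
  choose b hb hgap using fun i => hcompact.exists_forall_le'
    (continuous_const.sub (hcont i)).continuousOn fun x hx => sub_pos.2 (hlt i x hx)
  obtain ⟨γ, hγ, hγb⟩ := Pi.exists_forall_pos_add_lt hb
  refine ⟨γ, hγ, fun i x hxr hεx => ?_⟩
  have hbx := hgap i x ⟨mem_closedBall_zero_iff.2 hxr, hεx⟩
  rw [Pi.sub_apply] at hbx
  linarith [hγb i]

end Gap

section Ties

open scoped Pointwise

variable {E : Type*} [NormedAddCommGroup E] [NormedSpace ℝ E]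

theorem norm_sub_norm_sub_lt_of_notMem_span [StrictConvexSpace ℝ E] {w y : E} {t : ℝ}
    (hw : w ∉ Submodule.span ℝ {y}) (ht : 0 < t) :
    ‖y‖ - ‖y - w‖ < ‖y + t • w‖ - ‖y + t • w - w‖ := by
  have hray : ¬SameRay ℝ (t • (y - w)) (y + t • w) := by
    intro h
    obtain ⟨-, r, -, -, -, -, hr⟩ := h.exists_eq_smul_add
    rw [show t • (y - w) + (y + t • w) = (1 + t) • y by module] at hr
    refine hw (Submodule.mem_span_singleton.2 ⟨t⁻¹ * (r * (1 + t) - 1), ?_⟩)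
    rw [mul_smul, sub_smul, mul_smul, ← hr, one_smul, add_sub_cancel_left, inv_smul_smul₀ ht.ne']
  have hlt : (1 + t) * ‖y‖ < t * ‖y - w‖ + ‖y + t • w‖ := by
    calc (1 + t) * ‖y‖ = ‖t • (y - w) + (y + t • w)‖ := by
          rw [show t • (y - w) + (y + t • w) = (1 + t) • y by module,
            norm_smul_of_nonneg (by positivity)]
      _ < ‖t • (y - w)‖ + ‖y + t • w‖ := norm_add_lt_of_not_sameRay hray
      _ = t * ‖y - w‖ + ‖y + t • w‖ := by rw [norm_smul_of_nonneg ht.le]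
  have hle : (1 + t) * ‖y + t • w - w‖ ≤ ‖y - w‖ + t * ‖y + t • w‖ := by
    calc (1 + t) * ‖y + t • w - w‖ = ‖y - w + t • (y + t • w)‖ := by
          rw [show y - w + t • (y + t • w) = (1 + t) • (y + t • w - w) by module,
            norm_smul_of_nonneg (by positivity)]
      _ ≤ ‖y - w‖ + ‖t • (y + t • w)‖ := norm_add_le _ _
      _ = ‖y - w‖ + t * ‖y + t • w‖ := by rw [norm_smul_of_nonneg ht.le]
  refine lt_of_mul_lt_mul_left ?_ (by positivity : 0 ≤ 1 + t)
  linarith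

variable [FiniteDimensional ℝ E] [MeasurableSpace E] [BorelSpace E]

theorem addHaar_eq_zero_of_forall_add_smul_notMem (ν : Measure E) [ν.IsAddHaarMeasure] {S : Set E}
    (hS : MeasurableSet S) (w : E) (hw : ∀ x ∈ S, ∀ t : ℝ, 0 < t → x + t • w ∉ S) : ν S = 0 := by
  have hdisjoint : ∀ r s : ℝ, r < s → Disjoint (({r • w} : Set E) + S) ({s • w} + S) := by
    intro r s hrs
    simp only [singleton_add, disjoint_left, forall_mem_image]
    rintro x hx ⟨y, hy, hyx : s • w + y = r • w + x⟩
    refine hw y hy (s - r) (sub_pos.2 hrs) ?_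
    rwa [sub_smul, ← add_sub_assoc, add_comm y, hyx, add_sub_cancel_left]
  obtain ⟨t, ht, htI, -⟩ := exists_seq_strictMono_tendsto' (zero_lt_one' ℝ)
  refine Measure.addHaar_eq_zero_of_disjoint_translates ν (fun n => t n • w) ?_
    ((pairwise_disjoint_on _).2 fun m n hmn => hdisjoint _ _ (ht hmn)) hS
  refine (isBounded_iff_forall_norm_le).2 ⟨‖w‖, forall_mem_range.2 fun n => ?_⟩
  rw [norm_smul_of_nonneg (htI n).1.le]
  exact mul_le_of_le_one_left (norm_nonneg w) (htI n).2.le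

theorem addHaar_preimage_sub_span_singleton (ν : Measure E) [ν.IsAddHaarMeasure]
    (hE : 1 < Module.finrank ℝ E) (a w : E) :
    ν {x | x - a ∈ Submodule.span ℝ {w}} = 0 := by
  have htop : Submodule.span ℝ {w} ≠ ⊤ := fun h => by
    have hle := finrank_span_le_card (R := ℝ) {w}
    rw [h, finrank_top, toFinset_singleton, Finset.card_singleton] at hle
    exact hE.not_ge hle
  simp only [sub_eq_add_neg, ← SetLike.mem_coe]
  exact (measure_preimage_add_right ν (-a) _).trans (Measure.addHaar_submodule ν _ htop)

/-- Off the line through `a` and `b`, translating `x` by `t • (b - a)` strictly increases the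
difference `‖a - x‖ - ‖b - x‖`, so the translates of a level set are disjoint. -/
theorem addHaar_norm_sub_sub_norm_sub_eq [StrictConvexSpace ℝ E] (ν : Measure E)
    [ν.IsAddHaarMeasure] (hE : 1 < Module.finrank ℝ E) {a b : E} (hab : a ≠ b) (s : ℝ) :
    ν {x | ‖a - x‖ - ‖b - x‖ = s} = 0 := by
  set L : Set E := {x | x - a ∈ Submodule.span ℝ {b - a}}
  set H : Set E := {x | ‖a - x‖ - ‖b - x‖ = s} with hH
  have hH_meas : MeasurableSet H := measurableSet_eq_fun (by fun_prop) (by fun_prop)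
  have hL_meas : MeasurableSet L :=
    ((Submodule.closed_of_finiteDimensional _).preimage (by fun_prop)).measurableSet
  have hoff : ν (H \ L) = 0 := by
    refine addHaar_eq_zero_of_forall_add_smul_notMem ν (hH_meas.diff hL_meas) (b - a) ?_
    rintro x ⟨hxH, hxL⟩ t ht ⟨hxtH, -⟩
    have hnotMem : b - a ∉ Submodule.span ℝ {x - a} := by
      intro h
      obtain ⟨r, hr⟩ := Submodule.mem_span_singleton.1 h
      refine hxL (Submodule.mem_span_singleton.2 ⟨r⁻¹, ?_⟩)
      rw [← hr, inv_smul_smul₀]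
      rintro rfl
      exact hab (sub_eq_zero.1 (hr.symm.trans (zero_smul ℝ _))).symm
    have hlt := norm_sub_norm_sub_lt_of_notMem_span hnotMem ht
    rw [hH, mem_ofPred_eq, norm_sub_rev a, norm_sub_rev b] at hxH hxtH
    rw [sub_sub_sub_cancel_right, sub_add_eq_add_sub, sub_sub_sub_cancel_right] at hlt
    linarith
  exact measure_mono_null (fun x hx => (em (x ∈ L)).symm.imp_left (And.intro hx))
    (measure_union_null hoff (addHaar_preimage_sub_span_singleton ν hE a (b - a)))

theorem measure_pi_eq_zero_of_update {ι : Type*} [Fintype ι] [DecidableEq ι] {X : ι → Type*}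
    [∀ i, MeasurableSpace (X i)] (μ : ∀ i, Measure (X i)) [∀ i, SigmaFinite (μ i)]
    {S : Set (∀ i, X i)} (hS : MeasurableSet S) (a : ι)
    (h : ∀ v, μ a {x | Function.update v a x ∈ S} = 0) : Measure.pi μ S = 0 := by
  rcases isEmpty_or_nonempty (∀ i, X i) with hempty | ⟨⟨v₀⟩⟩
  · rw [eq_empty_of_isEmpty S, measure_empty]
  set f : (∀ i, X i) → ℝ≥0∞ := S.indicator 1 with hf
  have hf_meas : Measurable f := measurable_one.indicator hS
  have hsection : (fun v => ∫⁻ x, f (Function.update v a x) ∂μ a) = 0 :=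
    funext fun v => (lintegral_indicator_one (measurable_update v hS)).trans (h v)
  rw [← lintegral_indicator_one hS, ← hf, lintegral_eq_lmarginal_univ v₀,
    lmarginal_erase' _ hf_meas (Finset.mem_univ a), hsection]
  simp [lmarginal]

theorem ae_pi_injective {X : Type*} [MeasurableSpace X] [MeasurableEq X] {κ : Type*} [Fintype κ]
    (μ : Measure X) [SigmaFinite μ] (hμ : ∀ x, μ {x} = 0) :
    ∀ᵐ u ∂Measure.pi fun _ : κ => μ, Function.Injective u := by
  classical
  simp only [Function.injective_iff_pairwise_ne, Pairwise, ae_all_iff]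
  intro l l' hll'
  have hmeas : MeasurableSet {u : κ → X | u l = u l'} :=
    measurableSet_eq_fun (by fun_prop) (by fun_prop)
  have hnull : (Measure.pi fun _ : κ => μ) {u | u l = u l'} = 0 :=
    measure_pi_eq_zero_of_update _ hmeas l fun u => by
      simpa [Function.update_of_ne hll'.symm] using hμ (u l')
  exact measure_mono_null (fun u hu => not_not.1 hu) hnull

theorem totalDist_update {E κ : Type*} [SeminormedAddCommGroup E] [Fintype κ] [DecidableEq κ]
    (u : κ → E) (l : κ) (x y : E) :
    totalDist (Function.update u l x) y = totalDist u y - ‖y - u l‖ + ‖y - x‖ := by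
  unfold totalDist
  rw [← Finset.add_sum_erase _ _ (Finset.mem_univ l), Function.update_self, add_comm,
    ← Finset.sum_erase_eq_sub (f := fun q => ‖y - u q‖) (Finset.mem_univ l)]
  congr 1
  exact Finset.sum_congr rfl fun q hq => by rw [Function.update_of_ne (Finset.ne_of_mem_erase hq)]

variable [StrictConvexSpace ℝ E] {κ : Type*} [Fintype κ]

theorem pi_totalDist_eq_totalDist (ν : Measure E) [ν.IsAddHaarMeasure]
    (hE : 1 < Module.finrank ℝ E) {μ : Measure E} [SigmaFinite μ] (hμ : μ ≪ ν) {l l' l₀ : κ}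
    (hl : l ≠ l₀) (hl' : l' ≠ l₀) :
    (Measure.pi fun _ : κ => μ)
      {u | u l ≠ u l' ∧ totalDist u (u l) = totalDist u (u l')} = 0 := by
  classical
  have hmeas : MeasurableSet
      {u : κ → E | u l ≠ u l' ∧ totalDist u (u l) = totalDist u (u l')} := by
    unfold totalDist
    exact (measurableSet_eq_fun (by fun_prop) (by fun_prop)).compl.inter
      (measurableSet_eq_fun (by fun_prop) (by fun_prop))
  refine measure_pi_eq_zero_of_update _ hmeas l₀ fun u => ?_
  simp only [mem_ofPred_eq, totalDist_update, Function.update_of_ne hl, Function.update_of_ne hl']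
  by_cases hne : u l = u l'
  · simp [hne]
  · refine measure_mono_null (fun x hx => ?_) (hμ (addHaar_norm_sub_sub_norm_sub_eq ν hE hne
      (totalDist u (u l') - ‖u l' - u l₀‖ - (totalDist u (u l) - ‖u l - u l₀‖))))
    rw [mem_ofPred_eq]
    linarith [hx.2]

theorem ae_injective_totalDist (ν : Measure E) [ν.IsAddHaarMeasure]
    (hE : 1 < Module.finrank ℝ E) {μ : Measure E} [SigmaFinite μ] (hμ : μ ≪ ν)
    (hκ : 2 < Fintype.card κ) :
    ∀ᵐ u ∂Measure.pi fun _ : κ => μ, Function.Injective fun l => totalDist u (u l) := by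
  classical
  have : Nontrivial E := Module.nontrivial_of_finrank_pos (R := ℝ) (by omega)
  have hties : ∀ᵐ u ∂Measure.pi fun _ : κ => μ, ∀ l l', u l ≠ u l' →
      totalDist u (u l) ≠ totalDist u (u l') := by
    simp only [ae_all_iff]
    intro l l'
    obtain ⟨l₀, hl₀⟩ := Finset.exists_mem_notMem_of_card_lt_card
      (Finset.card_le_two.trans_lt hκ : ({l, l'} : Finset κ).card < Finset.univ.card)
    simp only [Finset.mem_univ, Finset.mem_insert, Finset.mem_singleton, not_or, true_and] at hl₀
    filter_upwards [compl_mem_ae_iff.2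
      (pi_totalDist_eq_totalDist ν hE hμ (Ne.symm hl₀.1) (Ne.symm hl₀.2))] with u hu hne heq
    exact hu ⟨hne, heq⟩
  filter_upwards [ae_pi_injective (κ := κ) μ fun x => hμ (measure_singleton x), hties]
    with u hinj hu l l' heq
  exact hinj (not_not.1 (mt (hu l l') (not_not.2 heq)))

end Ties
section ProductMeasure

open Filter Topology ProbabilityTheory

variable {X : Type*} [MeasurableSpace X] (μ : Measure X) [IsProbabilityMeasure μ]

theorem pi_abs_sum_sub_ge_le {κ : Type*} [Fintype κ] {φ : X → ℝ} (hφ : MemLp φ 2 μ) {t : ℝ}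
    (ht : 0 < t) :
    (Measure.pi fun _ : κ => μ) {u | t ≤ |∑ l, φ (u l) - Fintype.card κ * ∫ x, φ x ∂μ|} ≤
      ENNReal.ofReal (Fintype.card κ * Var[φ; μ] / t ^ 2) := by
  have hmem : ∀ l, MemLp (fun u : κ → X => φ (u l)) 2 (Measure.pi fun _ : κ => μ) := fun l =>
    hφ.comp_measurePreserving (measurePreserving_eval (fun _ => μ) l)
  have hmean : ∫ u, ∑ l, φ (u l) ∂(Measure.pi fun _ : κ => μ) = Fintype.card κ * ∫ x, φ x ∂μ := by
    rw [integral_finsetSum _ fun l _ => (hmem l).integrable one_le_two]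
    simp [integral_comp_eval (μ := fun _ : κ => μ) hφ.aestronglyMeasurable]
  have hvar : Var[∑ l, fun u : κ → X => φ (u l); Measure.pi fun _ : κ => μ] =
      Fintype.card κ * Var[φ; μ] := by
    simp [variance_sum_pi (μ := fun _ : κ => μ) fun _ => hφ]
  have hchebyshev := meas_ge_le_variance_div_sq (memLp_finsetSum' Finset.univ fun l _ => hmem l) ht
  simpa only [Finset.sum_apply, hmean, hvar] using hchebyshev

theorem tendsto_pi_abs_sum_sub_ge {φ : X → ℝ} (hφ : MemLp φ 2 μ) {η : ℝ} (hη : 0 < η) :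
    Tendsto (fun n : ℕ => (Measure.pi fun _ : Fin n => μ)
      {u | n * η ≤ |∑ l, φ (u l) - n * ∫ x, φ x ∂μ|}) atTop (𝓝 0) := by
  have hbound : ∀ n : ℕ, 0 < n → (Measure.pi fun _ : Fin n => μ)
      {u | n * η ≤ |∑ l, φ (u l) - n * ∫ x, φ x ∂μ|} ≤
        ENNReal.ofReal (Var[φ; μ] / η ^ 2 / n) := by
    intro n hn
    have hle := pi_abs_sum_sub_ge_le (κ := Fin n) μ hφ (t := n * η) (by positivity)
    rw [Fintype.card_fin] at hle
    refine hle.trans_eq (congrArg ENNReal.ofReal ?_)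
    field_simp
  refine tendsto_of_tendsto_of_tendsto_of_le_of_le' tendsto_const_nhds ?_
    (Eventually.of_forall fun _ => zero_le) ((eventually_gt_atTop 0).mono hbound)
  simpa using ENNReal.tendsto_ofReal (tendsto_const_div_atTop_nhds_zero_nat (Var[φ; μ] / η ^ 2))

theorem tendsto_pi_forall_notMem {A : Set X} (hA : MeasurableSet A) (hμA : μ A ≠ 0) :
    Tendsto (fun n : ℕ => (Measure.pi fun _ : Fin n => μ) {u | ∀ l, u l ∉ A}) atTop (𝓝 0) := by
  have hpow : ∀ n : ℕ, (Measure.pi fun _ : Fin n => μ) {u | ∀ l, u l ∉ A} = μ Aᶜ ^ n := fun n => by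
    have hpi : {u : Fin n → X | ∀ l, u l ∉ A} = univ.pi fun _ => Aᶜ := by ext; simp
    rw [hpi, Measure.pi_pi, Finset.prod_const, Finset.card_univ, Fintype.card_fin]
  simp only [hpow]
  refine ENNReal.tendsto_pow_atTop_nhds_zero_of_lt_one ?_
  rw [prob_compl_eq_one_sub hA]
  exact ENNReal.sub_lt_self ENNReal.one_ne_top one_ne_zero hμA

theorem measurePreserving_curry_apply {ι κ : Type*} [Fintype ι] [Fintype κ] (i : ι) :
    MeasurePreserving (fun v : ι × κ → X => Function.curry v i) (Measure.pi fun _ => μ)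
      (Measure.pi fun _ => μ) := by
  have hcurry : MeasurePreserving (MeasurableEquiv.curry ι κ X) (Measure.pi fun _ => μ)
      (Measure.pi fun _ => Measure.pi fun _ => μ) :=
    ⟨MeasurableEquiv.measurable _, by
      simpa only [Measure.infinitePi_eq_pi] using
        Measure.infinitePi_map_curry (ι := ι) (κ := κ) fun _ _ => μ⟩
  exact (measurePreserving_eval _ i).comp hcurry

theorem pi_exists_curry_mem_le {ι κ : Type*} [Fintype ι] [Fintype κ] (S : Set (κ → X)) :
    (Measure.pi fun _ : ι × κ => μ) {v | ∃ i, Function.curry v i ∈ S} ≤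
      Fintype.card ι * (Measure.pi fun _ : κ => μ) S := by
  have hrow : ∀ i : ι, (Measure.pi fun _ : ι × κ => μ) {v | Function.curry v i ∈ S} ≤
      (Measure.pi fun _ : κ => μ) S := fun i => by
    have hpreserve := measurePreserving_curry_apply (κ := κ) μ i
    exact (Measure.le_map_apply hpreserve.aemeasurable S).trans_eq (by rw [hpreserve.map_eq])
  calc (Measure.pi fun _ : ι × κ => μ) {v | ∃ i, Function.curry v i ∈ S}
      ≤ ∑ i, (Measure.pi fun _ : ι × κ => μ) {v | Function.curry v i ∈ S} := by
        rw [ofPred_exists]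
        exact measure_iUnion_fintype_le _ _
    _ ≤ ∑ _i : ι, (Measure.pi fun _ : κ => μ) S := Finset.sum_le_sum fun i _ => hrow i
    _ = Fintype.card ι * (Measure.pi fun _ : κ => μ) S := by
        rw [Finset.sum_const, Finset.card_univ, nsmul_eq_mul]

theorem WithHighProbability.of_tendsto_measure_compl {Ω : ℕ → Type*} [∀ n, MeasurableSpace (Ω n)]
    {Pr : ∀ n, Measure (Ω n)} {A : ∀ n, Set (Ω n)}
    (h : Tendsto (fun n => Pr n (A n)ᶜ) atTop (𝓝 0)) : WithHighProbability Pr A := by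
  intro δ hδ _
  obtain ⟨N, hN⟩ := eventually_atTop.1 (h.eventually_lt_const (ENNReal.ofReal_pos.2 hδ))
  exact ⟨N, fun n hn => hN n hn.le⟩

theorem WithHighProbability.of_tendsto_pi_not_curry {ι : Type*} [Fintype ι]
    {A : ∀ n : ℕ, Set (Fin n → X)} {B : ∀ n : ℕ, Set (ι × Fin n → X)}
    (hA : Tendsto (fun n => (Measure.pi fun _ : Fin n => μ) (A n)ᶜ) atTop (𝓝 0))
    (hAB : ∀ n v, (∀ i, Function.curry v i ∈ A n) → v ∈ B n) :
    WithHighProbability (fun n => Measure.pi fun _ : ι × Fin n => μ) B := by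
  have hlim := ENNReal.Tendsto.const_mul hA (.inr (ENNReal.natCast_ne_top (Fintype.card ι)))
  rw [mul_zero] at hlim
  refine .of_tendsto_measure_compl (tendsto_of_tendsto_of_tendsto_of_le_of_le tendsto_const_nhds
    hlim (fun _ => zero_le) fun n => (measure_mono fun v hv => ?_).trans
      (pi_exists_curry_mem_le μ (A n)ᶜ))
  exact not_forall.1 (mt (hAB n v) hv)

end ProductMeasure

section TypicalSampleProbability

open Filter Topology

variable {E : Type*} [SeminormedAddCommGroup E]

theorem abs_sampleContribution_sub_le {κ : Type*} [Fintype κ] (a : ℝ) (u : κ → E) (x y : E) :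
    |sampleContribution a u x - sampleContribution a u y| ≤ Fintype.card κ * ‖x - y‖ := by
  unfold sampleContribution
  rw [← Finset.sum_sub_distrib, ← nsmul_eq_mul]
  exact (Finset.abs_sum_le_sum_abs _ _).trans
    (Finset.sum_le_card_nsmul _ _ _ fun l _ => abs_max_sub_norm_sub_le a x y (u l))

variable [MeasurableSpace E]

theorem abs_sampleContribution_sub_meanContribution_le [OpensMeasurableSpace E] (μ : Measure E)
    [IsProbabilityMeasure μ] {n : ℕ} (a : ℝ) (u : Fin n → E) (x y : E) :
    |sampleContribution a u x - n * meanContribution μ a x| ≤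
      |sampleContribution a u y - n * meanContribution μ a y| + n * (2 * ‖x - y‖) := by
  have hsample := abs_sampleContribution_sub_le a u x y
  have hmean : |n * meanContribution μ a y - n * meanContribution μ a x| ≤ n * ‖x - y‖ := by
    rw [← mul_sub, abs_mul, Nat.abs_cast, norm_sub_rev]
    gcongr
    simpa using abs_meanContribution_sub_le μ a y x
  rw [Fintype.card_fin] at hsample
  calc |sampleContribution a u x - n * meanContribution μ a x|
      = |(sampleContribution a u y - n * meanContribution μ a y) +
          (sampleContribution a u x - sampleContribution a u y) +
          (n * meanContribution μ a y - n * meanContribution μ a x)| := by congr 1; ring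
    _ ≤ |sampleContribution a u y - n * meanContribution μ a y| + n * ‖x - y‖ + n * ‖x - y‖ :=
        (abs_add_three _ _ _).trans (by gcongr)
    _ = |sampleContribution a u y - n * meanContribution μ a y| + n * (2 * ‖x - y‖) := by ring

theorem tendsto_pi_not_forall_abs_sub_le [OpensMeasurableSpace E] (μ : Measure E)
    [IsProbabilityMeasure μ] (b : ℝ) {K : Set E} (hK : IsCompact K) {η : ℝ} (hη : 0 < η) :
    Tendsto (fun n : ℕ => (Measure.pi fun _ : Fin n => μ)
      {u | ¬∀ x ∈ K, |sampleContribution b u x - n * meanContribution μ b x| ≤ n * η})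
      atTop (𝓝 0) := by
  obtain ⟨t, -, ht_fin, hKt⟩ := hK.finite_cover_balls (show 0 < η / 4 by positivity)
  have hlim : Tendsto (fun n : ℕ => ∑ y ∈ ht_fin.toFinset, (Measure.pi fun _ : Fin n => μ)
      {u | n * (η / 2) ≤ |sampleContribution b u y - n * meanContribution μ b y|})
      atTop (𝓝 0) := by
    simpa [sampleContribution, meanContribution] using tendsto_finsetSum ht_fin.toFinset fun y _ =>
      tendsto_pi_abs_sum_sub_ge μ (memLp_max_sub_norm_sub μ b y 2) (half_pos hη)
  refine tendsto_of_tendsto_of_tendsto_of_le_of_le tendsto_const_nhds hlim (fun _ => zero_le)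
    fun n => (measure_mono fun u hu => ?_).trans (measure_biUnion_finset_le _ _)
  obtain ⟨x, hx, hxu⟩ : ∃ x ∈ K,
      n * η < |sampleContribution b u x - n * meanContribution μ b x| := by
    simpa using hu
  obtain ⟨y, hy, hxy⟩ := mem_iUnion₂.1 (hKt hx)
  rw [mem_ball_iff_norm] at hxy
  refine mem_iUnion₂.2 ⟨y, ht_fin.mem_toFinset.2 hy, ?_⟩
  rw [mem_ofPred_eq]
  have hle := abs_sampleContribution_sub_meanContribution_le μ b u x y
  have hη_half : n * (2 * ‖x - y‖) ≤ n * (η / 2) := by gcongr; linarith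
  linarith

theorem exists_pos_add_mul_le_dist {ι Y : Type*} [Finite ι] [PseudoMetricSpace Y] {c : ι → Y}
    {r : ℝ} (h : ∀ i j, i ≠ j → r < dist (c i) (c j)) :
    ∃ ε > 0, ∀ i j, i ≠ j → r + 4 * ε ≤ dist (c i) (c j) := by
  obtain ⟨δ, hδ, hlt⟩ := Pi.exists_forall_pos_add_lt
    fun q : {q : ι × ι // q.1 ≠ q.2} => h q.1.1 q.1.2 q.2
  exact ⟨δ / 4, by positivity, fun i j hij => by linarith [hlt ⟨(i, j), hij⟩]⟩

theorem tendsto_pi_not_isTypicalSample {E : Type*} [NormedAddCommGroup E] [NormedSpace ℝ E]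
    [StrictConvexSpace ℝ E] [FiniteDimensional ℝ E] [MeasurableSpace E] [BorelSpace E]
    {ν μ : Measure E} [ν.IsAddHaarMeasure] [IsProbabilityMeasure μ] (hE : 1 < Module.finrank ℝ E)
    (hμν : μ ≪ ν) (hμ : ∀ᵐ x ∂μ, ‖x‖ ≤ 1) {η : ℝ} (hη : 0 < η) (hμη : μ (closedBall 0 η) ≠ 0)
    {K : Set E} (hK : IsCompact K) (b : ℝ) :
    Tendsto (fun n : ℕ => (Measure.pi fun _ : Fin n => μ)
      {u | ¬IsTypicalSample (meanContribution μ b) K b η u}) atTop (𝓝 0) := by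
  have hlim := (tendsto_pi_forall_notMem μ measurableSet_closedBall hμη).add
    (tendsto_pi_not_forall_abs_sub_le μ b hK hη)
  rw [add_zero] at hlim
  refine tendsto_of_tendsto_of_tendsto_of_le_of_le' tendsto_const_nhds hlim
    (Eventually.of_forall fun _ => zero_le) ((eventually_gt_atTop 2).mono fun n hn => ?_)
  have hnorm : ∀ᵐ u ∂Measure.pi fun _ : Fin n => μ, ∀ l, ‖u l‖ ≤ 1 := ae_all_iff.2 fun l =>
    (measurePreserving_eval (fun _ : Fin n => μ) l).quasiMeasurePreserving.ae hμ
  have hinj := ae_injective_totalDist (κ := Fin n) ν hE hμν (by rwa [Fintype.card_fin])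
  refine (measure_mono_ae ?_).trans (measure_union_le _ _)
  filter_upwards [hnorm, hinj] with u hu_norm hu_inj hu
  by_contra hgood
  obtain ⟨hnear, huniform⟩ := not_or.1 hgood
  exact hu ⟨hu_norm, by simpa using hnear, not_not.1 huniform, hu_inj⟩

end TypicalSampleProbability

end KMedian

open MeasureTheory Filter Topology KMedian in
theorem mainTheorem7_general {E : Type*} [NormedAddCommGroup E] [NormedSpace ℝ E]
    [StrictConvexSpace ℝ E] [FiniteDimensional ℝ E] [MeasurableSpace E] [BorelSpace E]
    (hE : 1 < Module.finrank ℝ E) (ν : Measure E) [ν.IsAddHaarMeasure] {k : ℕ} (c : Fin k → E)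
    (μ : Measure E) [IsProbabilityMeasure μ] (p : E → ENNReal) (hp : Measurable p)
    (hdensity : μ = (ν.restrict (Metric.closedBall 0 1)).withDensity p)
    (hdecreasing : RadiallyStrictAntiOn p (Metric.closedBall 0 1))
    (hsep : ∀ i j, i ≠ j → 2 < dist (c i) (c j)) :
    WithHighProbability (fun n => Measure.pi fun _ : Fin k × Fin n => μ)
      fun _ => {v | ExactRecovery (ballDist c v) Prod.fst} := by
  have : Nontrivial E := Module.nontrivial_of_finrank_pos (R := ℝ) (zero_lt_one.trans hE)
  have hμ_restrict : μ ≪ ν.restrict (Metric.closedBall 0 1) :=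
    hdensity ▸ withDensity_absolutelyContinuous _ _
  have hμν : μ ≪ ν := hμ_restrict.trans Measure.restrict_le_self.absolutelyContinuous
  have hμ_norm : ∀ᵐ x ∂μ, ‖x‖ ≤ 1 := hμ_restrict.ae_le <|
    (ae_restrict_mem measurableSet_closedBall).mono fun _ => mem_closedBall_zero_iff.1
  obtain ⟨ε, hε, hsepε⟩ := exists_pos_add_mul_le_dist hsep
  obtain ⟨γ, hγ, hgap⟩ := exists_gap_sum_meanContribution hp hdecreasing hdensity zero_lt_one
    (by linarith : 1 < 1 + 2 * ε) (fun i j hij => by linarith [hsepε i j hij]) hε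
  obtain ⟨η, hη, hηε, hηγ⟩ : ∃ η > 0, 2 * η ≤ ε ∧ 3 * k * η < γ := by
    obtain ⟨η, hη, hlt⟩ := exists_pos_mul_lt (lt_min hε hγ) (2 + 3 * k)
    have hkη : 0 ≤ 3 * k * η := by positivity
    exact ⟨η, hη, by linarith [lt_min_iff.1 hlt], by linarith [lt_min_iff.1 hlt]⟩
  have hg := meanContribution_le_meanContribution_zero hp hdecreasing hdensity zero_lt_one
    (by linarith : 0 < 1 + 2 * ε)
  have hK : IsCompact (⋃ i, ⋃ j, Metric.closedBall (c i - c j) 1) :=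
    isCompact_iUnion fun i => isCompact_iUnion fun j => isCompact_closedBall _ _
  have htypical := tendsto_pi_not_isTypicalSample hE hμν hμ_norm hη
    (measure_closedBall_zero_pos hp hdecreasing hdensity zero_lt_one hη).ne' hK (1 + 2 * ε)
  refine .of_tendsto_pi_not_curry μ htypical fun n v hv =>
    exactRecovery_of_isTypicalSample hηε hηγ hsepε (fun i j => ?_) hg hgap hv
  exact Set.subset_iUnion₂_of_subset i j subset_rfl

theorem mainTheorem7 (m : ℕ) (hm : 2 ≤ m) (k : ℕ) (hk : 1 ≤ k)
    (c : Fin k → EuclideanSpace ℝ (Fin m))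
    (μ : Measure (EuclideanSpace ℝ (Fin m))) [IsProbabilityMeasure μ]
    (hball : μ (Metric.closedBall 0 1)ᶜ = 0)
    (ha1 : KMedian.RotationInvariant μ)
    (ha2 : KMedian.PositiveNearCenter μ)
    (ha3 : KMedian.NullOnLebesgueNull μ)
    (p : EuclideanSpace ℝ (Fin m) → ENNReal) (hp : Measurable p)
    (hdensity : μ = (volume.restrict (Metric.closedBall 0 1)).withDensity p)
    (hdecreasing : ∀ x₁ ∈ Metric.closedBall (0 : EuclideanSpace ℝ (Fin m)) 1,
      ∀ x₂ ∈ Metric.closedBall (0 : EuclideanSpace ℝ (Fin m)) 1, ‖x₁‖ < ‖x₂‖ → p x₂ < p x₁)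
    (hsep : ∀ i j, i ≠ j → 2 < dist (c i) (c j)) :
    KMedian.WithHighProbability (fun n => KMedian.sampleLaw k n μ)
      (fun n => KMedian.recoveryEvent n c) :=
  mainTheorem7_general (by rwa [finrank_euclideanSpace_fin]) volume c μ p hp hdensity hdecreasing
    hsep
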